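/- \textbf{Theorem (Moments of the $2\times 2$ complex Wishart distribution).} Let $\nu$ be a nonnegative integer and let $Z_t=(z_{t1},z_{t2})$, $t=1,\dots,\nu$, be independent random vectors with the complex normal distribution $CN_2(0,I)$; that is, $Z_t=X_t+\sqrt{-1}\,Y_t$, where $(X_t,Y_t)$ is a real Gaussian vector in $\mathbb{R}^4$ with mean $0$ and covariance matrix $\tfrac12 I_4$. Let the random Hermitian matrix $W=(w_{ij})_{1\le i,j\le 2}$ have the complex Wishart distribution $CW_2(\nu,I)$, i.e. the law of the matrix with entries $\sum_{t=1}^{\nu} z_{ti}\overline{z_{tj}}$. Then for all nonnegative integers $a,b,c$ the random variable $w_{11}^b(w_{12}w_{21})^a w_{22}^c$ is integrable and $$ E\bigl[w_{11}^b (w_{12}w_{21})^a w_{22}^c\bigr] = a!\,\prod_{i=1}^{a}(\nu+a-i)\,\prod_{i=1}^{b}(\nu+a+b-i)\,\prod_{i=1}^{c}(\nu+a+c-i). $$ -/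

import Mathlib

open MeasureTheory ProbabilityTheory

/-- The real covariance matrix of the stacked vector `(X, Y)` for a complex normal vector
`Z = X + i Y` with covariance `S = 2 (A + i B)`, i.e. the block matrix `[A, -B; B, A]`. -/
noncomputable def complexNormalRealCov {ι : Type*} (S : Matrix ι ι ℂ) : Matrix (ι ⊕ ι) (ι ⊕ ι) ℝ :=
  Matrix.fromBlocks (S.map fun z => z.re / 2) (-(S.map fun z => z.im / 2))
    (S.map fun z => z.im / 2) (S.map fun z => z.re / 2)

/-- The complex normal distribution `CN(m, S)`: the law of `Z = X + i Y`, where `(X, Y)` is a real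
Gaussian vector with mean `(Re m, Im m)` and covariance `[A, -B; B, A]`, `S = 2 (A + i B)`.
It is meaningful when `S` is positive semidefinite. -/
noncomputable def complexNormal {ι : Type*} [Fintype ι] [DecidableEq ι]
    (m : ι → ℂ) (S : Matrix ι ι ℂ) : Measure (ι → ℂ) :=
  (multivariateGaussian
      (WithLp.toLp 2 (Sum.elim (fun i => (m i).re) (fun i => (m i).im)))
      (complexNormalRealCov S)).map
    fun v i => (v (Sum.inl i) : ℂ) + Complex.I * (v (Sum.inr i) : ℂ)

instance isProbabilityMeasure_complexNormal {ι : Type*} [Fintype ι] [DecidableEq ι]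
    (m : ι → ℂ) (S : Matrix ι ι ℂ) :
    IsProbabilityMeasure (complexNormal m S) :=
  Measure.isProbabilityMeasure_map (Measurable.aemeasurable (by fun_prop))

/-- The Wishart matrix `w i j = ∑ t, z t i * conj (z t j)` built from the vectors `z t`. -/
def complexWishartMatrix {ι : Type*} {ν : ℕ} (z : Fin ν → ι → ℂ) : Matrix ι ι ℂ :=
  Matrix.of fun i j => ∑ t, z t i * (starRingEnd ℂ) (z t j)

/-- Matrices carry the product sigma-algebra of their entries. -/
noncomputable instance matrixComplexMeasurableSpace {ι : Type*} : MeasurableSpace (Matrix ι ι ℂ) :=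
  (MeasurableSpace.pi : MeasurableSpace (ι → ι → ℂ))

/-- The central complex Wishart distribution `CW(ν, S)`: the law of the Wishart matrix built from
`ν` independent `CN(0, S)` vectors. -/
noncomputable def complexWishart {ι : Type*} [Fintype ι] [DecidableEq ι] (ν : ℕ)
    (S : Matrix ι ι ℂ) : Measure (Matrix ι ι ℂ) :=
  (Measure.pi fun _ : Fin ν => complexNormal (0 : ι → ℂ) S).map complexWishartMatrix

theorem measurable_complexWishartMatrix {ι : Type*} {ν : ℕ} :
    Measurable (complexWishartMatrix : (Fin ν → ι → ℂ) → Matrix ι ι ℂ) := by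
  have h : Measurable (starRingEnd ℂ) := Complex.continuous_conj.measurable
  have key : Measurable (fun (z : Fin ν → ι → ℂ) (i j : ι) =>
      ∑ t, z t i * (starRingEnd ℂ) (z t j)) := by
    refine measurable_pi_lambda _ fun i => measurable_pi_lambda _ fun j => ?_
    refine Finset.measurable_sum _ fun t _ => ?_
    exact Measurable.mul (by fun_prop) (h.comp (by fun_prop))
  exact key

instance isProbabilityMeasure_complexWishart {ι : Type*} [Fintype ι] [DecidableEq ι]
    (ν : ℕ) (S : Matrix ι ι ℂ) :
    IsProbabilityMeasure (complexWishart ν S) :=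
  Measure.isProbabilityMeasure_map measurable_complexWishartMatrix.aemeasurable

/-!
# Moments of the `2 × 2` complex Wishart distribution

The proof is Gaussian integration by parts on polynomials. The Wishart law with identity covariance
is the image of independent real Gaussians of variance `1 / 2` (`complexWishart_one`), and the moment
is the expectation of a polynomial in these coordinates. For a polynomial `p`, integration by parts
reads `E[z p] = E[∂p/∂z̄]` for each complex coordinate `z` (`gaussianExpect_zPoly_mul`).

Summing over the `ν` vectors gives
`E[w_{ij} p] = ν δ_{ij} E[p] + E[D_{ji} p]`, `D_{ji} = ∑ t, z̄_{tj} ∂/∂z̄_{ti}`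
(`gaussianExpect_wishartPoly_mul`), and the derivation `D_{ji}` acts on the entries by
`w_{kl} ↦ δ_{li} w_{kj}` (`wishartDerivation_wishartPoly`). With `M(a, b, c)` the expectation of
`w₁₁ᵇ (w₁₂ w₂₁)ᵃ w₂₂ᶜ`, this yields
`M(a, b + 1, c) = (ν + a + b) M(a, b, c)`, `M(a, b, c + 1) = (ν + a + c) M(a, b, c)` and
`M(a + 1, 0, 0) = (a + 1) M(a, 0, 1) = (a + 1) (ν + a) M(a, 0, 0)`,
which determine all moments from `M(0, 0, 0) = 1`.
-/

/-! ### Gaussian integration by parts for polynomials -/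

open MvPolynomial in
/-- The expectation of a polynomial with complex coefficients in independent real Gaussian variables
of mean `0` and variance `v`. -/
noncomputable def gaussianExpect {J : Type*} [Fintype J] (v : NNReal) (p : MvPolynomial J ℂ) : ℂ :=
  ∫ x, eval (fun j => ((x j : ℝ) : ℂ)) p ∂(Measure.pi fun _ : J => gaussianReal 0 v)

theorem integrable_pow_gaussianReal (m : ℝ) (v : NNReal) (n : ℕ) :
    Integrable (fun x : ℝ => x ^ n) (gaussianReal m v) := by
  have h := (memLp_id_gaussianReal (μ := m) (v := v) n).integrable_norm_pow'
  refine h.mono' (by fun_prop) (Filter.Eventually.of_forall fun x => ?_)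
  simp

theorem integrable_mul_gaussianPDFReal_pow {m : ℝ} {v : NNReal} (hv : v ≠ 0) (n : ℕ) :
    Integrable (fun x : ℝ => x ^ n * gaussianPDFReal m v x) := by
  have h := integrable_pow_gaussianReal m v n
  rw [gaussianReal_of_var_ne_zero _ hv, integrable_withDensity_iff_integrable_smul'
    (measurable_gaussianPDF _ _) (Filter.Eventually.of_forall fun _ => gaussianPDF_lt_top)] at h
  simpa [mul_comm] using h

theorem hasDerivAt_gaussianPDFReal_zero (v : NNReal) (x : ℝ) :
    HasDerivAt (gaussianPDFReal 0 v) (-(x / v) * gaussianPDFReal 0 v x) x := by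
  have h : HasDerivAt (fun y : ℝ => -(y - 0) ^ 2 / (2 * (v : ℝ))) (-(x / v)) x := by
    refine ((((hasDerivAt_id x).sub_const 0).pow 2).neg.div_const (2 * (v : ℝ))).congr_deriv ?_
    simp only [id, sub_zero]
    ring
  refine (h.exp.const_mul (√(2 * Real.pi * v))⁻¹).congr_deriv ?_
  rw [gaussianPDFReal]
  ring

/-- The moment recursion of the centred Gaussian. For `n = 0` the truncated exponent `n - 1` is
harmless, since it is multiplied by `n`. -/
theorem integral_pow_succ_gaussianReal (v : NNReal) (n : ℕ) :
    ∫ x, x ^ (n + 1) ∂(gaussianReal 0 v) = v * (n * ∫ x, x ^ (n - 1) ∂(gaussianReal 0 v)) := by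
  rcases eq_or_ne v 0 with rfl | hv
  · simp
  have hv' : (v : ℝ) ≠ 0 := by exact_mod_cast hv
  rw [integral_gaussianReal_eq_integral_smul hv, integral_gaussianReal_eq_integral_smul hv]
  have key := integral_mul_deriv_eq_deriv_mul_of_integrable
    (u := fun x : ℝ => x ^ n) (u' := fun x => n * x ^ (n - 1))
    (v := gaussianPDFReal 0 v) (v' := fun x => -(x / v) * gaussianPDFReal 0 v x)
    (fun x _ => hasDerivAt_pow n x) (fun x _ => hasDerivAt_gaussianPDFReal_zero v x)
    (by
      refine ((integrable_mul_gaussianPDFReal_pow (m := 0) hv (n + 1)).const_mul (-(v : ℝ)⁻¹)).congr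
        (Filter.Eventually.of_forall fun x => ?_)
      simp only [Pi.mul_apply]; ring)
    (by
      refine ((integrable_mul_gaussianPDFReal_pow (m := 0) hv (n - 1)).const_mul (n : ℝ)).congr
        (Filter.Eventually.of_forall fun x => ?_)
      simp only [Pi.mul_apply]; ring)
    (integrable_mul_gaussianPDFReal_pow hv n)
  have h1 : ∀ x : ℝ, gaussianPDFReal 0 v x • x ^ (n + 1)
      = -(v : ℝ) * (x ^ n * (-(x / v) * gaussianPDFReal 0 v x)) := fun x => by
    simp only [smul_eq_mul]; field_simp; ring
  simp_rw [h1]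
  rw [integral_const_mul, key, ← integral_const_mul (n : ℝ)]
  simp_rw [smul_eq_mul]
  rw [neg_mul_neg]
  congr 2
  funext x; ring

theorem integral_ofReal_pow_succ_gaussianReal (v : NNReal) (n : ℕ) :
    ∫ x, (x : ℂ) ^ (n + 1) ∂(gaussianReal 0 v)
      = v * (n * ∫ x, (x : ℂ) ^ (n - 1) ∂(gaussianReal 0 v)) := by
  simp_rw [← Complex.ofReal_pow, integral_complex_ofReal, integral_pow_succ_gaussianReal]
  push_cast
  rfl

section Polynomial

open MvPolynomial

variable {J : Type*} [Fintype J] (v : NNReal)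

theorem eval_monomial_eq_prod {R : Type*} [CommSemiring R] (x : J → R) (s : J →₀ ℕ) (a : R) :
    eval x (monomial s a) = a * ∏ j, x j ^ s j := by
  rw [eval_monomial, Finsupp.prod_fintype _ _ fun _ => pow_zero _]

theorem integrable_eval_pi_gaussianReal (p : MvPolynomial J ℂ) :
    Integrable (fun x : J → ℝ => eval (fun j => (x j : ℂ)) p)
      (Measure.pi fun _ : J => gaussianReal 0 v) := by
  induction p using MvPolynomial.induction_on' with
  | monomial s a =>
    simp_rw [eval_monomial_eq_prod]
    refine Integrable.const_mul ?_ a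
    refine Integrable.fintype_prod (f := fun j (y : ℝ) => (y : ℂ) ^ s j) fun j => ?_
    simpa using (integrable_pow_gaussianReal 0 v (s j)).ofReal (𝕜 := ℂ)
  | add p q hp hq =>
    simp only [map_add]
    exact hp.add hq

theorem gaussianExpect_add (p q : MvPolynomial J ℂ) :
    gaussianExpect v (p + q) = gaussianExpect v p + gaussianExpect v q := by
  simp only [gaussianExpect, map_add]
  exact integral_add (integrable_eval_pi_gaussianReal v p) (integrable_eval_pi_gaussianReal v q)

theorem gaussianExpect_smul (a : ℂ) (p : MvPolynomial J ℂ) :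
    gaussianExpect v (a • p) = a * gaussianExpect v p := by
  simp only [gaussianExpect, smul_eval]
  exact integral_const_mul _ _

theorem gaussianExpect_sum {T : Type*} (s : Finset T) (p : T → MvPolynomial J ℂ) :
    gaussianExpect v (∑ t ∈ s, p t) = ∑ t ∈ s, gaussianExpect v (p t) := by
  simp only [gaussianExpect, map_sum]
  exact integral_finsetSum _ fun t _ => integrable_eval_pi_gaussianReal v (p t)

theorem gaussianExpect_one : gaussianExpect v (1 : MvPolynomial J ℂ) = 1 := by
  simp [gaussianExpect]

theorem gaussianExpect_monomial (s : J →₀ ℕ) (a : ℂ) :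
    gaussianExpect v (monomial s a) = a * ∏ j, ∫ x, (x : ℂ) ^ s j ∂(gaussianReal 0 v) := by
  simp_rw [gaussianExpect, eval_monomial_eq_prod]
  rw [integral_const_mul,
    integral_fintype_prod_eq_prod (f := fun j (y : ℝ) => (y : ℂ) ^ s j)]

/-- Gaussian integration by parts, `E[x_j p] = v E[∂p/∂x_j]`. By linearity it reduces to monomials,
whose expectations factor into one-dimensional moments. -/
theorem gaussianExpect_X_mul (j : J) (p : MvPolynomial J ℂ) :
    gaussianExpect v (X j * p) = v * gaussianExpect v (pderiv j p) := by
  classical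
  induction p using MvPolynomial.induction_on' with
  | monomial s a =>
    set M : ℕ → ℂ := fun n => ∫ x, (x : ℂ) ^ n ∂(gaussianReal 0 v)
    have hsplit (u : J →₀ ℕ) (hu : ∀ i ≠ j, u i = s i) :
        ∏ i, M (u i) = M (u j) * ∏ i ∈ Finset.univ.erase j, M (s i) := by
      rw [← Finset.mul_prod_erase _ _ (Finset.mem_univ j)]
      congr 1
      exact Finset.prod_congr rfl fun i hi => by rw [hu i (Finset.ne_of_mem_erase hi)]
    have hM : M (s j + 1) = v * (s j * M (s j - 1)) := integral_ofReal_pow_succ_gaussianReal v (s j)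
    rw [X, monomial_mul, pderiv_monomial, gaussianExpect_monomial, gaussianExpect_monomial,
      hsplit (Finsupp.single j 1 + s) fun i hi => by simp [Finsupp.single_eq_of_ne hi],
      hsplit (s - Finsupp.single j 1) fun i hi => by simp [Finsupp.single_eq_of_ne hi],
      Finsupp.add_apply, Finsupp.tsub_apply, Finsupp.single_eq_same, add_comm 1 (s j), hM]
    ring
  | add p q hp hq => rw [mul_add, map_add, gaussianExpect_add, gaussianExpect_add, hp, hq, mul_add]

end Polynomial

/-! ### The Wishart law in real Gaussian coordinates -/

theorem multivariateGaussian_zero_smul_one {ι : Type*} [Fintype ι] [DecidableEq ι] (v : NNReal) :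
    multivariateGaussian 0 ((v : ℝ) • (1 : Matrix ι ι ℝ))
      = (Measure.pi fun _ : ι => gaussianReal 0 v).map (WithLp.toLp 2) := by
  have : IsProbabilityMeasure ((Measure.pi fun _ : ι => gaussianReal 0 v).map (WithLp.toLp 2)) :=
    Measure.isProbabilityMeasure_map (by fun_prop)
  refine Measure.ext_of_charFun (E := EuclideanSpace ℝ ι) ?_
  ext t
  rw [charFun_multivariateGaussian (Matrix.PosSemidef.one.smul v.coe_nonneg), charFun_pi]
  simp_rw [charFun_gaussianReal, ← Complex.exp_sum]
  congr 1
  simp [Matrix.smul_mulVec, dotProduct, Finset.sum_div, Finset.sum_neg_distrib]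
  refine Finset.sum_congr rfl fun i _ => by ring

theorem complexNormal_zero_one {ι : Type*} [Fintype ι] [DecidableEq ι] :
    complexNormal (0 : ι → ℂ) 1 = (Measure.pi fun _ : ι ⊕ ι => gaussianReal 0 (1 / 2)).map
      fun x i => (x (Sum.inl i) : ℂ) + Complex.I * (x (Sum.inr i) : ℂ) := by
  have hS : complexNormalRealCov (1 : Matrix ι ι ℂ)
      = (((1 / 2 : NNReal) : NNReal) : ℝ) • (1 : Matrix (ι ⊕ ι) (ι ⊕ ι) ℝ) := by
    rw [complexNormalRealCov, ← Matrix.fromBlocks_one, Matrix.fromBlocks_smul]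
    congr 1 <;> ext i j <;> by_cases h : i = j <;> simp [h]
  have hm : (WithLp.toLp 2 (Sum.elim (fun i : ι => ((0 : ι → ℂ) i).re)
      (fun i : ι => ((0 : ι → ℂ) i).im)) : EuclideanSpace ℝ (ι ⊕ ι)) = 0 := by
    ext i; cases i <;> simp
  rw [complexNormal, hS, hm, multivariateGaussian_zero_smul_one, Measure.map_map]
  · rfl
  · fun_prop
  · fun_prop

/-- The Wishart law with identity covariance is the image of a product of real Gaussians of variance
`1 / 2`, indexed by the vector, the real or imaginary part, and the coordinate. -/
theorem complexWishart_one {ι : Type*} [Fintype ι] [DecidableEq ι] (ν : ℕ) :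
    complexWishart ν (1 : Matrix ι ι ℂ)
      = (Measure.pi fun _ : Fin ν × (ι ⊕ ι) => gaussianReal 0 (1 / 2)).map fun x =>
        complexWishartMatrix fun t i =>
          (x (t, Sum.inl i) : ℂ) + Complex.I * (x (t, Sum.inr i) : ℂ) := by
  have hf : Measurable fun (x : ι ⊕ ι → ℝ) (i : ι) =>
      (x (Sum.inl i) : ℂ) + Complex.I * (x (Sum.inr i) : ℂ) := by fun_prop
  have : SigmaFinite ((Measure.pi fun _ : ι ⊕ ι => gaussianReal 0 (1 / 2)).map
      fun (x : ι ⊕ ι → ℝ) (i : ι) =>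
        (x (Sum.inl i) : ℂ) + Complex.I * (x (Sum.inr i) : ℂ)) := by
    rw [← complexNormal_zero_one]; infer_instance
  have hc := Measure.infinitePi_map_curry
    (fun (_ : Fin ν) (_ : ι ⊕ ι) => gaussianReal 0 (1 / 2))
  simp only [Measure.infinitePi_eq_pi] at hc
  rw [complexWishart, complexNormal_zero_one, ← Measure.pi_map_pi fun _ => hf.aemeasurable, ← hc,
    Measure.map_map measurable_complexWishartMatrix (by fun_prop),
    Measure.map_map (measurable_complexWishartMatrix.comp (by fun_prop)) (by fun_prop)]
  rfl

/-! ### Wirtinger calculus on the Wishart entries -/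

section Wirtinger

open MvPolynomial

variable {ι : Type*} {ν : ℕ}

/-- The coordinate `z_{t i} = x_{t i} + i y_{t i}` as a polynomial in the real coordinates: the
variable `(t, Sum.inl i)` is `x_{t i}` and `(t, Sum.inr i)` is `y_{t i}`. -/
noncomputable def zPoly (t : Fin ν) (i : ι) : MvPolynomial (Fin ν × (ι ⊕ ι)) ℂ :=
  X (t, Sum.inl i) + Complex.I • X (t, Sum.inr i)

/-- The conjugate coordinate `x_{t i} - i y_{t i}` as a polynomial. -/
noncomputable def zbarPoly (t : Fin ν) (i : ι) : MvPolynomial (Fin ν × (ι ⊕ ι)) ℂ :=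
  X (t, Sum.inl i) - Complex.I • X (t, Sum.inr i)

/-- The Wirtinger derivation `∂/∂z̄_{t i} = (∂/∂x_{t i} + i ∂/∂y_{t i}) / 2`. -/
noncomputable def dbar (t : Fin ν) (i : ι) : Derivation ℂ (MvPolynomial (Fin ν × (ι ⊕ ι)) ℂ)
    (MvPolynomial (Fin ν × (ι ⊕ ι)) ℂ) :=
  (1 / 2 : ℂ) • (pderiv (t, Sum.inl i) + Complex.I • pderiv (t, Sum.inr i))

theorem dbar_zPoly (t s : Fin ν) (i j : ι) : dbar t i (zPoly s j) = 0 := by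
  classical
  simp only [dbar, zPoly, Derivation.smul_apply, Derivation.add_apply, map_add, Derivation.map_smul,
    pderiv_X, Pi.single_apply, Prod.mk.injEq, Sum.inl.injEq, Sum.inr.injEq, reduceCtorEq, and_false,
    if_false, smul_zero, add_zero, zero_add]
  split_ifs
  · match_scalars
    linear_combination (1 / 2 : ℂ) * Complex.I_mul_I
  · simp

theorem dbar_zbarPoly [DecidableEq ι] (t s : Fin ν) (i j : ι) :
    dbar t i (zbarPoly s j) = if s = t ∧ j = i then 1 else 0 := by
  classical
  simp only [dbar, zbarPoly, Derivation.smul_apply, Derivation.add_apply, map_sub,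
    Derivation.map_smul, pderiv_X, Pi.single_apply, Prod.mk.injEq, Sum.inl.injEq, Sum.inr.injEq,
    reduceCtorEq, and_false, if_false, smul_zero]
  split_ifs
  · match_scalars
    linear_combination (-1 / 2 : ℂ) * Complex.I_mul_I
  · simp

/-- Complex Gaussian integration by parts, `E[z p] = E[∂p/∂z̄]`. The variance `1 / 2` of the real
coordinates supplies the factor `1 / 2` of the Wirtinger derivation. -/
theorem gaussianExpect_zPoly_mul [Fintype ι] (t : Fin ν) (i : ι)
    (p : MvPolynomial (Fin ν × (ι ⊕ ι)) ℂ) :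
    gaussianExpect (1 / 2) (zPoly t i * p) = gaussianExpect (1 / 2) (dbar t i p) := by
  rw [zPoly, add_mul, smul_mul_assoc, gaussianExpect_add, gaussianExpect_smul,
    gaussianExpect_X_mul, gaussianExpect_X_mul, dbar, Derivation.smul_apply, gaussianExpect_smul,
    Derivation.add_apply, Derivation.smul_apply, gaussianExpect_add, gaussianExpect_smul]
  push_cast
  ring

variable (ν) in
/-- The Wishart entry `w_{i j} = ∑ t, z_{t i} z̄_{t j}` as a polynomial. -/
noncomputable def wishartPoly (i j : ι) : MvPolynomial (Fin ν × (ι ⊕ ι)) ℂ :=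
  ∑ t : Fin ν, zPoly t i * zbarPoly t j

variable (ν) in
/-- The derivation `∑ t, z̄_{t i} ∂/∂z̄_{t j}`. -/
noncomputable def wishartDerivation (i j : ι) :
    Derivation ℂ (MvPolynomial (Fin ν × (ι ⊕ ι)) ℂ) (MvPolynomial (Fin ν × (ι ⊕ ι)) ℂ) :=
  ∑ t : Fin ν, zbarPoly t i • dbar t j

theorem wishartDerivation_apply (i j : ι) (p : MvPolynomial (Fin ν × (ι ⊕ ι)) ℂ) :
    wishartDerivation ν i j p = ∑ t : Fin ν, zbarPoly t i * dbar t j p := by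
  rw [wishartDerivation, ← Derivation.coeFnAddMonoidHom_apply, map_sum, Finset.sum_apply]
  rfl

/-- The derivation replaces the second index `j` of a Wishart entry by `i` and kills the entries
with another second index, so it preserves polynomials in the entries. -/
theorem wishartDerivation_wishartPoly [DecidableEq ι] (i j k l : ι) :
    wishartDerivation ν i j (wishartPoly ν k l) = if l = j then wishartPoly ν k i else 0 := by
  simp only [wishartDerivation_apply, wishartPoly, map_sum, Derivation.leibniz, dbar_zPoly,
    dbar_zbarPoly, smul_eq_mul, mul_zero, mul_ite, mul_one]
  split_ifs with h
  · simp [h]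
  · simp [h]

/-- Integration by parts for a Wishart entry. The term with `ν` comes from the derivative hitting
the conjugate coordinates inside the entry itself. -/
theorem gaussianExpect_wishartPoly_mul [Fintype ι] [DecidableEq ι] (i j : ι)
    (p : MvPolynomial (Fin ν × (ι ⊕ ι)) ℂ) :
    gaussianExpect (1 / 2) (wishartPoly ν i j * p)
      = (if i = j then (ν : ℂ) else 0) * gaussianExpect (1 / 2) p
        + gaussianExpect (1 / 2) (wishartDerivation ν j i p) := by
  simp only [wishartPoly, Finset.sum_mul, mul_assoc, gaussianExpect_sum, gaussianExpect_zPoly_mul,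
    Derivation.leibniz, dbar_zbarPoly, wishartDerivation_apply, gaussianExpect_add, smul_eq_mul,
    Finset.sum_add_distrib, true_and, eq_comm (a := j)]
  rw [add_comm]
  congr 1
  split_ifs <;> simp [gaussianExpect]

theorem eval_wishartPoly (x : Fin ν × (ι ⊕ ι) → ℝ) (i j : ι) :
    eval (fun k => (x k : ℂ)) (wishartPoly ν i j)
      = complexWishartMatrix (fun t i =>
          (x (t, Sum.inl i) : ℂ) + Complex.I * (x (t, Sum.inr i) : ℂ)) i j := by
  simp [wishartPoly, complexWishartMatrix, zPoly, zbarPoly, smul_eval, sub_eq_add_neg]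

end Wirtinger

theorem Derivation.pow_eq_smul_of_eq_smul {R A : Type*} [CommSemiring R] [CommSemiring A]
    [Algebra R A] (D : Derivation R A A) {x : A} {k : ℕ} (h : D x = k • x) (n : ℕ) :
    D (x ^ n) = (n * k) • x ^ n := by
  rw [Derivation.leibniz_pow, h]
  cases n with
  | zero => simp
  | succ n => simp only [nsmul_eq_mul, smul_eq_mul, Nat.add_sub_cancel]; push_cast; ring

/-! ### Moment recursions -/

section Moments

variable (ν a b c : ℕ)

/-- The polynomial `w₁₁ᵇ (w₁₂ w₂₁)ᵃ w₂₂ᶜ`, with the matrix indices `1, 2` being `0, 1 : Fin 2`. -/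
noncomputable def wishartMonomial : MvPolynomial (Fin ν × (Fin 2 ⊕ Fin 2)) ℂ :=
  wishartPoly ν 0 0 ^ b * (wishartPoly ν 0 1 * wishartPoly ν 1 0) ^ a * wishartPoly ν 1 1 ^ c

/-- The monomial is an eigenvector of `wishartDerivation ν 0 0`, which counts the entries with second
index `0`. -/
theorem gaussianExpect_wishartMonomial_succ_left :
    gaussianExpect (1 / 2) (wishartMonomial ν a (b + 1) c)
      = (ν + a + b) * gaussianExpect (1 / 2) (wishartMonomial ν a b c) := by
  have hD : wishartDerivation ν 0 0 (wishartMonomial ν a b c)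
      = ((a + b : ℕ) : ℂ) • wishartMonomial ν a b c := by
    have h1 := (wishartDerivation ν (0 : Fin 2) 0).pow_eq_smul_of_eq_smul
      (x := wishartPoly ν 0 0) (k := 1) (by simp [wishartDerivation_wishartPoly]) b
    have h2 := (wishartDerivation ν (0 : Fin 2) 0).pow_eq_smul_of_eq_smul
      (x := wishartPoly ν 0 1 * wishartPoly ν 1 0) (k := 1)
      (by simp [wishartDerivation_wishartPoly]) a
    have h3 := (wishartDerivation ν (0 : Fin 2) 0).pow_eq_smul_of_eq_smul
      (x := wishartPoly ν 1 1) (k := 0) (by simp [wishartDerivation_wishartPoly]) c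
    rw [wishartMonomial, Derivation.leibniz, Derivation.leibniz, h1, h2, h3, Nat.cast_smul_eq_nsmul]
    simp only [nsmul_eq_mul, smul_eq_mul]
    push_cast
    ring
  have hm : wishartMonomial ν a (b + 1) c = wishartPoly ν 0 0 * wishartMonomial ν a b c := by
    simp only [wishartMonomial]; ring
  rw [hm, gaussianExpect_wishartPoly_mul, hD, gaussianExpect_smul, if_pos rfl]
  push_cast
  ring

theorem gaussianExpect_wishartMonomial_succ_right :
    gaussianExpect (1 / 2) (wishartMonomial ν a b (c + 1))
      = (ν + a + c) * gaussianExpect (1 / 2) (wishartMonomial ν a b c) := by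
  have hD : wishartDerivation ν 1 1 (wishartMonomial ν a b c)
      = ((a + c : ℕ) : ℂ) • wishartMonomial ν a b c := by
    have h1 := (wishartDerivation ν (1 : Fin 2) 1).pow_eq_smul_of_eq_smul
      (x := wishartPoly ν 0 0) (k := 0) (by simp [wishartDerivation_wishartPoly]) b
    have h2 := (wishartDerivation ν (1 : Fin 2) 1).pow_eq_smul_of_eq_smul
      (x := wishartPoly ν 0 1 * wishartPoly ν 1 0) (k := 1)
      (by simp [wishartDerivation_wishartPoly, mul_comm]) a
    have h3 := (wishartDerivation ν (1 : Fin 2) 1).pow_eq_smul_of_eq_smul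
      (x := wishartPoly ν 1 1) (k := 1) (by simp [wishartDerivation_wishartPoly]) c
    rw [wishartMonomial, Derivation.leibniz, Derivation.leibniz, h1, h2, h3, Nat.cast_smul_eq_nsmul]
    simp only [nsmul_eq_mul, smul_eq_mul]
    push_cast
    ring
  have hm : wishartMonomial ν a b (c + 1) = wishartPoly ν 1 1 * wishartMonomial ν a b c := by
    simp only [wishartMonomial]; ring
  rw [hm, gaussianExpect_wishartPoly_mul, hD, gaussianExpect_smul, if_pos rfl]
  push_cast
  ring

/-- Integrating by parts in one factor `w₁₂` turns one of the `a + 1` factors `w₂₁` into `w₂₂`,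
which the recursion in `c` removes. -/
theorem gaussianExpect_wishartMonomial_succ_zero_zero :
    gaussianExpect (1 / 2) (wishartMonomial ν (a + 1) 0 0)
      = (a + 1) * (ν + a) * gaussianExpect (1 / 2) (wishartMonomial ν a 0 0) := by
  have hD : wishartDerivation ν 1 0 (wishartPoly ν 1 0 ^ (a + 1) * wishartPoly ν 0 1 ^ a)
      = ((a + 1 : ℕ) : ℂ) • wishartMonomial ν a 0 1 := by
    rw [Derivation.leibniz, (wishartDerivation ν (1 : Fin 2) 0).pow_eq_smul_of_eq_smul
      (x := wishartPoly ν 0 1) (k := 0) (by simp [wishartDerivation_wishartPoly]) a,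
      Derivation.leibniz_pow, wishartDerivation_wishartPoly, if_pos rfl, Nat.cast_smul_eq_nsmul]
    simp only [nsmul_eq_mul, smul_eq_mul, Nat.add_sub_cancel, wishartMonomial]
    push_cast
    ring
  have hm : wishartMonomial ν (a + 1) 0 0
      = wishartPoly ν 0 1 * (wishartPoly ν 1 0 ^ (a + 1) * wishartPoly ν 0 1 ^ a) := by
    simp only [wishartMonomial]; ring
  rw [hm, gaussianExpect_wishartPoly_mul, hD, gaussianExpect_smul,
    gaussianExpect_wishartMonomial_succ_right, if_neg (by decide)]
  push_cast
  ring

theorem prod_Icc_add_sub_eq_prod_range (x : ℂ) (n : ℕ) :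
    ∏ i ∈ Finset.Icc 1 n, (x + n - i) = ∏ i ∈ Finset.range n, (x + i) := by
  refine Finset.prod_nbij' (fun i => n - i) (fun i => n - i) ?_ ?_ ?_ ?_ fun i hi => ?_
  any_goals intro i hi; simp only [Finset.mem_Icc, Finset.mem_range] at hi ⊢; omega
  rw [Nat.cast_sub (Finset.mem_Icc.1 hi).2]
  ring

theorem gaussianExpect_wishartMonomial :
    gaussianExpect (1 / 2) (wishartMonomial ν a b c)
      = a.factorial * (∏ i ∈ Finset.range a, ((ν : ℂ) + i)) *
        (∏ i ∈ Finset.range b, ((ν : ℂ) + a + i)) * ∏ i ∈ Finset.range c, ((ν : ℂ) + a + i) := by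
  induction c with
  | succ c ih =>
    rw [gaussianExpect_wishartMonomial_succ_right, ih, Finset.prod_range_succ _ c]; ring
  | zero =>
    induction b with
    | succ b ih =>
      rw [gaussianExpect_wishartMonomial_succ_left, ih, Finset.prod_range_succ _ b]; ring
    | zero =>
      simp only [Finset.range_zero, Finset.prod_empty, mul_one]
      induction a with
      | succ a ih =>
        rw [gaussianExpect_wishartMonomial_succ_zero_zero, ih, Finset.prod_range_succ,
          Nat.factorial_succ]
        push_cast
        ring
      | zero => simp [wishartMonomial, gaussianExpect_one]

end Moments

theorem mainTheorem7 {Ω : Type*} [MeasurableSpace Ω] (P : Measure Ω)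
    (ν : ℕ) (W : Ω → Matrix (Fin 2) (Fin 2) ℂ)
    (hW : HasLaw W (complexWishart ν (1 : Matrix (Fin 2) (Fin 2) ℂ)) P) (a b c : ℕ) :
    Integrable (fun ω => W ω 0 0 ^ b * (W ω 0 1 * W ω 1 0) ^ a * W ω 1 1 ^ c) P ∧
    ∫ ω, W ω 0 0 ^ b * (W ω 0 1 * W ω 1 0) ^ a * W ω 1 1 ^ c ∂P =
      (a.factorial : ℂ) * (∏ i ∈ Finset.Icc 1 a, ((ν : ℂ) + a - i)) *
        (∏ i ∈ Finset.Icc 1 b, ((ν : ℂ) + a + b - i)) *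
        (∏ i ∈ Finset.Icc 1 c, ((ν : ℂ) + a + c - i)) := by
  let f : Matrix (Fin 2) (Fin 2) ℂ → ℂ := fun M => M 0 0 ^ b * (M 0 1 * M 1 0) ^ a * M 1 1 ^ c
  have hentry (i j : Fin 2) : Measurable fun M : Matrix (Fin 2) (Fin 2) ℂ => M i j :=
    (measurable_pi_apply j).comp (measurable_pi_apply i)
  have hf : Measurable f :=
    (((hentry 0 0).pow_const b).mul (((hentry 0 1).mul (hentry 1 0)).pow_const a)).mul
      ((hentry 1 1).pow_const c)
  have hg : Measurable fun (x : Fin ν × (Fin 2 ⊕ Fin 2) → ℝ) =>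
      (complexWishartMatrix fun t i => (x (t, Sum.inl i) : ℂ) + Complex.I * (x (t, Sum.inr i) : ℂ) :
        Matrix (Fin 2) (Fin 2) ℂ) :=
    measurable_complexWishartMatrix.comp (by fun_prop)
  have heval (x : Fin ν × (Fin 2 ⊕ Fin 2) → ℝ) :
      f (complexWishartMatrix fun t i =>
        (x (t, Sum.inl i) : ℂ) + Complex.I * (x (t, Sum.inr i) : ℂ))
        = MvPolynomial.eval (fun k => (x k : ℂ)) (wishartMonomial ν a b c) := by
    simp only [f, wishartMonomial, map_mul, map_pow, eval_wishartPoly]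
  constructor
  · change Integrable (f ∘ W) P
    rw [← integrable_map_measure hf.aestronglyMeasurable hW.aemeasurable, hW.map_eq,
      complexWishart_one, integrable_map_measure hf.aestronglyMeasurable hg.aemeasurable]
    exact (integrable_eval_pi_gaussianReal (1 / 2) (wishartMonomial ν a b c)).congr
      (Filter.Eventually.of_forall fun x => (heval x).symm)
  · have h := hW.integral_comp hf.aestronglyMeasurable
    rw [complexWishart_one, integral_map hg.aemeasurable hf.aestronglyMeasurable] at h
    simp_rw [prod_Icc_add_sub_eq_prod_range]
    rw [← gaussianExpect_wishartMonomial]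
    exact h.trans (integral_congr_ae (Filter.Eventually.of_forall heval))
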